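/- Let $X$ be a complex Banach space, $T:[0,\infty)\to B(X)$ a $C_0$-semigroup and $A:D(A)\subseteq X\to X$ its infinitesimal generator. Let $L^1_s(\mathbb R,B(X))$ be the set of all $K:\mathbb R\to B(X)$ such that $s\mapsto K(s)v$ is (Bochner) measurable for every $v\in X$ and $\|K(s)\|\le f(s)$ a.e. for some $f\in L^1(\mathbb R)$; let $\|K\|_1$ be the infimum of $\|f\|_1$ over all such $f$. Let $\mathcal F=\mathcal F(\mathbb R,X)$ be a homogeneous Banach function space, that is, a complex Banach space of (a.e. classes of) measurable functions $\mathbb R\to X$ such that 1. $\mathcal F$ is continuously embedded in the Stepanov space $\mathcal S^1$, normed by $\|x\|_{\mathcal S^1}=\sup_{t\in\mathbb R}\int_0^1\|x(s+t)\|\,ds$; 2. for $x\in\mathcal F$ and $t\in\mathbb R$, the translate $s\mapsto x(t+s)$ belongs to $\mathcal F$ and has the same norm as $x$; 3. for $x\in\mathcal F$ and $C\in B(X)$, the function $y(t)=C(x(t))$ belongs to $\mathcal F$ and $\|y\|\le\|C\|\,\|x\|$; 4. for $x\in\mathcal F$ and $K\in L^1_s(\mathbb R,B(X))$, the convolution $(K*x)(t)=\int_{\mathbb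 R}K(s)x(t-s)\,ds$ belongs to $\mathcal F$ and $\|K*x\|\le\|K\|_1\|x\|$; 5. if $x\in\mathcal F$ and $f*x=0$ for all $f\in L^1(\mathbb R)$, then $x=0$. The operator $\mathscr L_{\mathcal F}=-d/dt+A$ on $\mathcal F$ is defined as follows: $x\in D(\mathscr L_{\mathcal F})$ and $\mathscr L_{\mathcal F}x=y$ if $x,y\in\mathcal F$ and (for a suitable representative of $x$) $$x(t)=T(t-s)x(s)-\int_s^tT(t-\tau)y(\tau)\,d\tau\qquad\text{for all } s\le t \text{ in } \mathbb R.$$ The Beurling spectrum of $x\in\mathcal F$ is $$\Lambda(x)=\mathbb R\setminus\{\lambda\in\mathbb R:\ \text{there is } f\in L^1(\mathbb R) \text{ with } \hat f(\lambda)\ne0 \text{ and } f*x=0\},\qquad \hat f(\lambda)=\int_{\mathbb R}f(t)e^{-it\lambda}\,dt.$$ Then: (a) if $x\in\ker\mathscr L_{\mathcal F}$, then $i\Lambda(x)\subseteq\sigma(A)\cap i\mathbb R$; (b) consequently, if $\sigma(A)\cap i\mathbb R=\emptyset$, then $\mathscr L_{\mathcal F}$ is injective. -/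

import Mathlib

open MeasureTheory Filter Topology
open scoped NNReal ENNReal

noncomputable section

namespace AbstractParabolic

/-! ### Semigroups, generators and spectra of unbounded operators -/

/-- A `C₀`-semigroup of bounded operators on a complex normed space `X`. -/
structure C0Semigroup (X : Type*) [NormedAddCommGroup X] [NormedSpace ℂ X] where
  /-- The operators `T(t)`, `t ≥ 0`. -/
  op : ℝ≥0 → X →L[ℂ] X
  op_zero : op 0 = ContinuousLinearMap.id ℂ X
  op_add : ∀ s t : ℝ≥0, op (s + t) = (op s).comp (op t)
  continuous_orbit : ∀ x : X, Continuous fun t : ℝ≥0 => op t x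

section Generator

variable {X : Type*} [NormedAddCommGroup X] [NormedSpace ℂ X]

/-- The right derivative at `0` of the orbit `t ↦ T(t)x` exists and equals `y`. -/
def C0Semigroup.HasGeneratorAt (T : C0Semigroup X) (x y : X) : Prop :=
  Tendsto (fun h : ℝ => ((h : ℂ)⁻¹) • (T.op h.toNNReal x - x)) (𝓝[>] (0 : ℝ)) (𝓝 y)

theorem C0Semigroup.HasGeneratorAt.add {T : C0Semigroup X} {x x' y y' : X}
    (h : T.HasGeneratorAt x y) (h' : T.HasGeneratorAt x' y') :
    T.HasGeneratorAt (x + x') (y + y') := by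
  have := Tendsto.add h h'
  refine this.congr fun r => ?_
  rw [← smul_add, map_add]
  congr 1
  abel

theorem C0Semigroup.HasGeneratorAt.smul {T : C0Semigroup X} {x y : X}
    (c : ℂ) (h : T.HasGeneratorAt x y) : T.HasGeneratorAt (c • x) (c • y) := by
  have := Tendsto.const_smul h c
  refine this.congr fun r => ?_
  rw [smul_comm, smul_sub, map_smul]

theorem C0Semigroup.HasGeneratorAt.zero (T : C0Semigroup X) : T.HasGeneratorAt 0 0 := by
  simp [C0Semigroup.HasGeneratorAt]

theorem C0Semigroup.HasGeneratorAt.unique {T : C0Semigroup X} {x y y' : X}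
    (h : T.HasGeneratorAt x y) (h' : T.HasGeneratorAt x y') : y = y' :=
  tendsto_nhds_unique h h'

/-- The infinitesimal generator `A : D(A) ⊆ X → X` of a `C₀`-semigroup `T`:
`D(A)` is the set of all `x` for which `lim_{h → 0+} (T(h)x - x)/h` exists, and `A x` is that
limit. -/
def C0Semigroup.generator (T : C0Semigroup X) : X →ₗ.[ℂ] X where
  domain :=
    { carrier := {x | ∃ y, T.HasGeneratorAt x y}
      add_mem' := fun ⟨y, hy⟩ ⟨y', hy'⟩ => ⟨y + y', hy.add hy'⟩
      zero_mem' := ⟨0, C0Semigroup.HasGeneratorAt.zero T⟩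
      smul_mem' := fun c _ ⟨y, hy⟩ => ⟨c • y, hy.smul c⟩ }
  toFun :=
    { toFun := fun x => Classical.choose x.2
      map_add' := fun x x' => (Classical.choose_spec (x + x').2).unique
        ((Classical.choose_spec x.2).add (Classical.choose_spec x'.2))
      map_smul' := fun c x => (Classical.choose_spec (c • x).2).unique
        ((Classical.choose_spec x.2).smul c) }

theorem C0Semigroup.generator_spec (T : C0Semigroup X) (x : T.generator.domain) :
    T.HasGeneratorAt (x : X) (T.generator x) :=
  Classical.choose_spec x.2

/-- The resolvent set `ρ(A)` of an unbounded operator `A : D(A) ⊆ X → X`: the set of all `z` such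
that `z - A : D(A) → X` is a bijection with a bounded inverse `R`. -/
def unboundedResolventSet (A : X →ₗ.[ℂ] X) : Set ℂ :=
  {z | ∃ R : X →L[ℂ] X,
    (∀ y : X, ∃ h : R y ∈ A.domain, z • R y - A ⟨R y, h⟩ = y) ∧
    ∀ x : A.domain, R (z • (x : X) - A x) = x}

/-- The spectrum `σ(A)` of an unbounded operator. -/
def unboundedSpectrum (A : X →ₗ.[ℂ] X) : Set ℂ := (unboundedResolventSet A)ᶜ

end Generator

/-! ### Homogeneous Banach function spaces

A Banach function space is a complex Banach space `F` together with a linear map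
`ι : F → L⁰(ℝ, X)` realising its elements as (Lebesgue-a.e. classes of) strongly measurable
functions; the injectivity of `ι` is part of the definition of a homogeneous space below. -/

section Homogeneous

variable {X : Type*} [NormedAddCommGroup X] [NormedSpace ℂ X]

/-- The Stepanov norm `‖u‖_{S¹} = sup_t ∫₀¹ ‖u(s + t)‖ ds`, with values in `[0, ∞]`. -/
def stepanovNorm (u : ℝ → X) : ℝ≥0∞ :=
  ⨆ t : ℝ, ∫⁻ s in Set.Icc (0 : ℝ) 1, ‖u (s + t)‖ₑ

/-- `f` is an integrable majorant of the operator-valued function `K`. -/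
def IsL1Majorant (K : ℝ → X →L[ℂ] X) (f : ℝ → ℝ) : Prop :=
  Integrable f ∧ ∀ᵐ s, ‖K s‖ ≤ f s

/-- The space `L¹_s(ℝ, B(X))`: all `K : ℝ → B(X)` for which every `s ↦ K(s)x` is (Bochner)
measurable and `‖K(·)‖` has an integrable majorant. -/
def MemL1s (K : ℝ → X →L[ℂ] X) : Prop :=
  (∀ x : X, AEStronglyMeasurable (fun s => K s x) volume) ∧ ∃ f : ℝ → ℝ, IsL1Majorant K f

/-- The norm of `L¹_s(ℝ, B(X))`: the infimum of the `L¹`-norms of the integrable majorants. -/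
def l1sNorm (K : ℝ → X →L[ℂ] X) : ℝ :=
  sInf {r : ℝ | ∃ f : ℝ → ℝ, IsL1Majorant K f ∧ r = ∫ s, |f s|}

/-- The convolution `(K * u)(t) = ∫ K(s) u(t - s) ds` with an operator-valued kernel. -/
def opConv (K : ℝ → X →L[ℂ] X) (u : ℝ → X) (t : ℝ) : X := ∫ s, K s (u (t - s))

/-- The convolution `(f * u)(t) = ∫ f(s) u(t - s) ds` with a scalar kernel. -/
def scalarConv (f : ℝ → ℂ) (u : ℝ → X) (t : ℝ) : X := ∫ s, f s • u (t - s)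

variable {F : Type*} [NormedAddCommGroup F] [NormedSpace ℂ F]

/-- The normed function space `ι : F → L⁰(ℝ, X)` is homogeneous. -/
structure IsHomogeneous (ι : F →ₗ[ℂ] (ℝ →ₘ[volume] X)) : Prop where
  /-- Elements of `F` are determined by the functions they represent. -/
  injective : Function.Injective ι
  /-- `F` is continuously embedded into the Stepanov space `S¹`. -/
  stepanov : ∃ C : ℝ≥0, ∀ x : F, stepanovNorm (ι x) ≤ C * ‖x‖ₑ
  /-- `F` is translation invariant and the translations are isometries. -/
  translation : ∀ (t : ℝ) (x : F), ∃ y : F,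
    (ι y =ᵐ[volume] fun s => ι x (t + s)) ∧ ‖y‖ = ‖x‖
  /-- `F` is invariant under pointwise application of bounded operators on `X`. -/
  pointwise : ∀ (C : X →L[ℂ] X) (x : F), ∃ y : F,
    (ι y =ᵐ[volume] fun t => C (ι x t)) ∧ ‖y‖ ≤ ‖C‖ * ‖x‖
  /-- `F` is invariant under convolution with kernels from `L¹_s(ℝ, B(X))`. -/
  convolution : ∀ (K : ℝ → X →L[ℂ] X), MemL1s K → ∀ x : F, ∃ y : F,
    (ι y =ᵐ[volume] opConv K (ι x)) ∧ ‖y‖ ≤ l1sNorm K * ‖x‖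
  /-- The `L¹(ℝ)`-module `F` is non-degenerate. -/
  nondegenerate : ∀ x : F,
    (∀ f : ℝ → ℂ, Integrable f → scalarConv f (ι x) =ᵐ[volume] 0) → x = 0

/-- The Fourier transform `f̂(λ) = ∫ f(t) e^{-itλ} dt`. -/
def fourierL1 (f : ℝ → ℂ) (l : ℝ) : ℂ := ∫ t, f t * Complex.exp (-(Complex.I * t * l))

/-- The Beurling spectrum `Λ(x)` of an element `x` of the `L¹(ℝ)`-module `F` (the module structure
being convolution): its complement consists of all `λ` for which there is `f ∈ L¹(ℝ)` with
`f̂(λ) ≠ 0` and `f * x = 0`. -/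
def beurlingSpectrum (ι : F →ₗ[ℂ] (ℝ →ₘ[volume] X)) (x : F) : Set ℝ :=
  {l : ℝ | ∃ f : ℝ → ℂ, Integrable f ∧ fourierL1 f l ≠ 0 ∧
    scalarConv f (ι x) =ᵐ[volume] 0}ᶜ

/-- The abstract parabolic operator `ℒ = -d/dt + A` on `F`, given by its graph:
`x ∈ D(ℒ)` and `ℒ x = y` if the class `x` has a representative `u` such that
`u(t) = T(t-s)u(s) - ∫_s^t T(t-τ)y(τ) dτ` for all `s ≤ t`. -/
def parabolicGraph (T : C0Semigroup X) (ι : F →ₗ[ℂ] (ℝ →ₘ[volume] X)) : Set (F × F) :=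
  {p | ∃ u : ℝ → X, u =ᵐ[volume] ι p.1 ∧ ∀ s t : ℝ, s ≤ t →
    u t = T.op (t - s).toNNReal (u s) - ∫ τ in s..t, T.op (t - τ).toNNReal (ι p.2 τ)}

/-- The kernel of `ℒ`: all `x ∈ D(ℒ)` with `ℒ x = 0`. -/
def parabolicKer (T : C0Semigroup X) (ι : F →ₗ[ℂ] (ℝ →ₘ[volume] X)) : Set F :=
  {x | (x, 0) ∈ parabolicGraph T ι}

/-- Injectivity of `ℒ`: the kernel is trivial and `ℒ x₁ = ℒ x₂` implies `x₁ = x₂`. -/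
def ParabolicInjective (T : C0Semigroup X) (ι : F →ₗ[ℂ] (ℝ →ₘ[volume] X)) : Prop :=
  parabolicKer T ι = {0} ∧
    ∀ x₁ x₂ y : F, (x₁, y) ∈ parabolicGraph T ι → (x₂, y) ∈ parabolicGraph T ι → x₁ = x₂

end Homogeneous

end AbstractParabolic

end

/-!
A function `x` in the kernel of `ℒ` is represented by a bounded continuous complete trajectory `u`
of the semigroup, because the semigroup is bounded on `[0, 1]` and `x` is Stepanov bounded. If the
symbol `k` vanishes outside `(l - ε, l + ε)`, then `w = k(D) u` is again a trajectory, so that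
`w' = A w`, and Bernstein's inequality `‖2πil w - w'‖ ≤ C ε ‖w‖` holds with `C` independent of `l`
and `ε`. When `2πil` is in the resolvent set of `A`, with resolvent `R`, this gives
`‖w‖ = ‖R (2πil w - w')‖ ≤ ‖R‖ C ε ‖w‖`, hence `w = 0` for small `ε`: the point `l` is not in the
spectrum of `u`. A bounded function with empty spectrum is zero, since partitions of unity give
`k(D) u = 0` for all compactly supported `k`, and suitable `k(D)` approximate the identity.
-/

noncomputable section

namespace AbstractParabolic

open Distribution
open scoped Real FourierTransform SchwartzMap BoundedContinuousFunction Manifold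

section Convolution

variable {X : Type*} [NormedAddCommGroup X] [NormedSpace ℂ X]

theorem integrable_smul_comp_sub_left {f : ℝ → ℂ} (hf : Integrable f) (u : ℝ →ᵇ X) (t : ℝ) :
    Integrable fun s => f s • u (t - s) :=
  hf.smul_bdd ‖u‖ (Continuous.aestronglyMeasurable (by fun_prop))
    (.of_forall fun s => u.norm_coe_le_norm _)

theorem norm_scalarConv_le {f : ℝ → ℂ} (hf : Integrable f) (u : ℝ →ᵇ X) (t : ℝ) :
    ‖scalarConv f u t‖ ≤ (∫ s, ‖f s‖) * ‖u‖ := by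
  rw [← integral_mul_const]
  refine norm_integral_le_of_norm_le (hf.norm.mul_const _) (.of_forall fun s => ?_)
  rw [norm_smul]
  gcongr
  exact u.norm_coe_le_norm _

theorem continuous_scalarConv {f : ℝ → ℂ} (hf : Integrable f) (u : ℝ →ᵇ X) :
    Continuous (scalarConv f u) :=
  BddAbove.continuous_convolution_right_of_integrable (μ := volume)
    (ContinuousLinearMap.lsmul ℂ ℂ) ⟨‖u‖, by rintro _ ⟨s, rfl⟩; exact u.norm_coe_le_norm s⟩
    hf u.continuous

theorem scalarConv_congr (f : ℝ → ℂ) {u v : ℝ → X} (h : u =ᵐ[volume] v) :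
    scalarConv f u = scalarConv f v := by
  funext t
  refine integral_congr_ae ?_
  filter_upwards [(quasiMeasurePreserving_sub_left_of_right_invariant volume t).ae h] with s hs
  rw [hs]

theorem scalarConv_scalarConv [CompleteSpace X] {f g : ℝ → ℂ} (hf : Integrable f)
    (hg : Integrable g) (u : ℝ →ᵇ X) :
    scalarConv f (scalarConv g u) = scalarConv (scalarConv f g) u := by
  funext t
  have hint : Integrable (Function.uncurry fun s r => f s • g (r - s) • u (t - r))
      (volume.prod volume) := by
    have hfg := (hf.convolution_integrand (.mul ℂ ℂ) hg).swap
    refine (hfg.smul_bdd ‖u‖ (f := fun p : ℝ × ℝ => u (t - p.2))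
      (Continuous.aestronglyMeasurable (by fun_prop))
      (.of_forall fun p => u.norm_coe_le_norm _)).congr (.of_forall fun p => ?_)
    simp [Function.uncurry, mul_smul]
  calc scalarConv f (scalarConv g u) t
      = ∫ s, ∫ r, f s • g (r - s) • u (t - r) := by
        refine integral_congr_ae (.of_forall fun s => ?_)
        dsimp only
        rw [scalarConv, ← integral_sub_right_eq_self _ s, ← integral_smul]
        simp only [sub_sub_sub_cancel_right]
    _ = ∫ r, ∫ s, f s • g (r - s) • u (t - r) := integral_integral_swap hint
    _ = scalarConv (scalarConv f g) u t := by
        refine integral_congr_ae (.of_forall fun r => ?_)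
        dsimp only
        rw [scalarConv, ← integral_smul_const]
        simp only [smul_assoc]

theorem intervalIntegral_scalarConv_of_hasDerivAt [CompleteSpace X] {f f' : ℝ → ℂ}
    (hf : Integrable f) (hf' : Integrable f') (hd : ∀ s, HasDerivAt f (f' s) s)
    (u : ℝ →ᵇ X) (a b : ℝ) :
    ∫ r in a..b, scalarConv f' u r = scalarConv f u b - scalarConv f u a := by
  have flip (g : ℝ → ℂ) (r : ℝ) : scalarConv g u r = ∫ s, g (r - s) • u s := by
    rw [scalarConv, ← integral_sub_left_eq_self _ _ r]
    simp only [sub_sub_cancel]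
  have hint : Integrable (Function.uncurry fun r s => f' (r - s) • u s)
      ((volume.restrict (Set.uIoc a b)).prod volume) := by
    have : IsFiniteMeasure (volume.restrict (Set.uIoc a b)) := ⟨by simp [Set.uIoc]⟩
    have shear : MeasurePreserving (fun p : ℝ × ℝ => (p.1, p.1 - p.2))
        ((volume.restrict (Set.uIoc a b)).prod volume)
        ((volume.restrict (Set.uIoc a b)).prod volume) :=
      (MeasurePreserving.id _).skew_product (g := fun r s => r - s) (by fun_prop)
        (.of_forall fun r => (volume.measurePreserving_sub_left r).map_eq)
    exact (shear.integrable_comp_of_integrable (hf'.comp_snd _)).smul_bdd ‖u‖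
      (Continuous.aestronglyMeasurable (by fun_prop)) (.of_forall fun p => u.norm_coe_le_norm _)
  calc ∫ r in a..b, scalarConv f' u r = ∫ r in a..b, ∫ s, f' (r - s) • u s := by simp only [flip]
    _ = ∫ s, ∫ r in a..b, f' (r - s) • u s := intervalIntegral_integral_swap hint
    _ = ∫ s, (f (b - s) - f (a - s)) • u s := by
      congr! 2 with s
      rw [intervalIntegral.integral_smul_const]
      congr 1
      exact intervalIntegral.integral_eq_sub_of_hasDerivAt
        (fun r _ => (hd (r - s)).comp_sub_const r s) (hf'.comp_sub_right s).intervalIntegrable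
    _ = scalarConv f u b - scalarConv f u a := by
      have hfu (r : ℝ) : Integrable fun s => f (r - s) • u s := by
        simpa using (integrable_smul_comp_sub_left hf u r).comp_sub_left r
      simp only [sub_smul, flip]
      exact integral_sub (hfu b) (hfu a)

theorem hasDerivAt_scalarConv [CompleteSpace X] {f f' : ℝ → ℂ} (hf : Integrable f)
    (hf' : Integrable f') (hd : ∀ s, HasDerivAt f (f' s) s) (u : ℝ →ᵇ X) (t : ℝ) :
    HasDerivAt (scalarConv f u) (scalarConv f' u t) t := by
  have hc := continuous_scalarConv hf' u
  have h := intervalIntegral.integral_hasDerivAt_right (hc.intervalIntegrable 0 t)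
    (hc.stronglyMeasurableAtFilter _ _) hc.continuousAt
  simp only [intervalIntegral_scalarConv_of_hasDerivAt hf hf' hd] at h
  simpa using h.add_const (scalarConv f u 0)

end Convolution

section FourierMultiplier

variable {X : Type*} [NormedAddCommGroup X] [NormedSpace ℂ X]

/-- The Fourier multiplier operator `k(D)` with Schwartz symbol `k`, applied to the bounded function
`u`: convolution of `u` with the inverse Fourier transform of `k`. For fixed `u` it is regarded as a
linear function of `k`, so that its distributional support is the spectrum of `u`, in the
normalisation where `t ↦ e^{2πilt}` has spectrum `{l}`. -/
def fourierMultiplier (u : ℝ →ᵇ X) : 𝓢(ℝ, ℂ) →ₗ[ℂ] ℝ →ᵇ X where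
  toFun k := .ofNormedAddCommGroup (scalarConv (𝓕⁻ k : 𝓢(ℝ, ℂ)) u)
    (continuous_scalarConv (𝓕⁻ k).integrable u) _ (norm_scalarConv_le (𝓕⁻ k).integrable u)
  map_add' k k' := by
    ext t
    rw [FourierTransform.fourierInv_add, BoundedContinuousFunction.coe_add, Pi.add_apply]
    simp only [BoundedContinuousFunction.coe_ofNormedAddCommGroup, scalarConv, add_apply, add_smul]
    exact integral_add (integrable_smul_comp_sub_left (𝓕⁻ k).integrable u t)
      (integrable_smul_comp_sub_left (𝓕⁻ k').integrable u t)
  map_smul' c k := by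
    ext t
    rw [FourierTransform.fourierInv_smul, BoundedContinuousFunction.coe_smul]
    simp only [BoundedContinuousFunction.coe_ofNormedAddCommGroup, scalarConv, smul_apply,
      smul_assoc]
    exact integral_smul c _

theorem fourierMultiplier_apply (u : ℝ →ᵇ X) (k : 𝓢(ℝ, ℂ)) (t : ℝ) :
    fourierMultiplier u k t = scalarConv (𝓕⁻ k : 𝓢(ℝ, ℂ)) u t := rfl

theorem norm_fourierMultiplier_le (u : ℝ →ᵇ X) (k : 𝓢(ℝ, ℂ)) :
    ‖fourierMultiplier u k‖ ≤ (∫ s, ‖(𝓕⁻ k) s‖) * ‖u‖ :=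
  (BoundedContinuousFunction.norm_le (by positivity)).2 (norm_scalarConv_le (𝓕⁻ k).integrable u)

theorem fourierMultiplier_fourierMultiplier [CompleteSpace X] (u : ℝ →ᵇ X) (a k : 𝓢(ℝ, ℂ)) :
    fourierMultiplier (fourierMultiplier u k) a =
      fourierMultiplier u (SchwartzMap.pairing (.mul ℂ ℂ) a k) := by
  have hconv : scalarConv (𝓕⁻ a : 𝓢(ℝ, ℂ)) (𝓕⁻ k : 𝓢(ℝ, ℂ)) =
      (𝓕⁻ (SchwartzMap.pairing (.mul ℂ ℂ) a k) : 𝓢(ℝ, ℂ)) := by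
    have h : 𝓕⁻ (SchwartzMap.pairing (.mul ℂ ℂ) a k) =
        SchwartzMap.convolution (.mul ℂ ℂ) (𝓕⁻ a) (𝓕⁻ k) := by
      simp [SchwartzMap.convolution]
    rw [h]
    exact funext fun t => (SchwartzMap.convolution_apply (.mul ℂ ℂ) _ _ t).symm
  ext t
  simp only [fourierMultiplier_apply, ← hconv]
  rw [← scalarConv_scalarConv (𝓕⁻ a).integrable (𝓕⁻ k).integrable]
  rfl

/-- The symbol `2πiξ k(ξ)` of the operator `d/dt k(D)`. -/
def derivSymbol (k : 𝓢(ℝ, ℂ)) : 𝓢(ℝ, ℂ) :=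
  (2 * π * Complex.I) • SchwartzMap.smulLeftCLM ℂ (fun ξ : ℝ => ξ) k

theorem derivSymbol_apply (k : 𝓢(ℝ, ℂ)) (ξ : ℝ) :
    derivSymbol k ξ = 2 * π * Complex.I * ξ * k ξ := by
  have hid : (fun ξ : ℝ => ξ).HasTemperateGrowth := by fun_prop
  simp [derivSymbol, SchwartzMap.smulLeftCLM_apply_apply hid, mul_assoc]

theorem hasDerivAt_fourierMultiplier [CompleteSpace X] (u : ℝ →ᵇ X) (k : 𝓢(ℝ, ℂ)) (t : ℝ) :
    HasDerivAt (fourierMultiplier u k) (fourierMultiplier u (derivSymbol k) t) t := by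
  have hsymbol : 𝓕⁻ (derivSymbol k) = LineDeriv.lineDerivOp (1 : ℝ) (𝓕⁻ k) := by
    simp [derivSymbol, SchwartzMap.lineDerivOp_fourierInv_eq]
  rw [fourierMultiplier_apply, hsymbol]
  exact hasDerivAt_scalarConv (𝓕⁻ k).integrable (SchwartzMap.integrable _)
    (fun s => (𝓕⁻ k).differentiableAt.hasDerivAt) u t

end FourierMultiplier

theorem exists_schwartzMap_eq_one {E : Type*} [NormedAddCommGroup E] [NormedSpace ℝ E]
    [FiniteDimensional ℝ E] (c : E) {r R : ℝ} (hr : 0 < r) (hrR : r < R) :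
    ∃ b : 𝓢(E, ℂ), tsupport b ⊆ Metric.closedBall c R ∧ ∀ x ∈ Metric.closedBall c r, b x = 1 := by
  let b : ContDiffBump c := ⟨r, R, hr, hrR⟩
  have hb : HasCompactSupport fun x => (b x : ℂ) :=
    b.hasCompactSupport.comp_left (g := Complex.ofReal) Complex.ofReal_zero
  have hsmooth : ContDiff ℝ (⊤ : ℕ∞) fun x => (b x : ℂ) :=
    Complex.ofRealCLM.contDiff.comp b.contDiff
  refine ⟨hb.toSchwartzMap hsmooth, ?_, fun x hx => ?_⟩
  · rw [← b.tsupport_eq]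
    exact tsupport_comp_subset Complex.ofReal_zero b
  · have hx1 : b x = 1 := b.one_of_mem_closedBall hx
    simp [hx1]

section Rescaling

/-- The symbol `ξ ↦ k (ε⁻¹ (ξ - l))`, which lives on a neighbourhood of `l` of size `ε` if `k` lives
on a neighbourhood of `0` of size `1`. -/
def rescale (l : ℝ) {ε : ℝ} (hε : ε ≠ 0) (k : 𝓢(ℝ, ℂ)) : 𝓢(ℝ, ℂ) :=
  SchwartzMap.compSubConstCLM ℂ l (SchwartzMap.compCLMOfContinuousLinearEquiv ℂ
    (ContinuousLinearEquiv.smulLeft (Units.mk0 ε hε)⁻¹) k)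

theorem rescale_apply (l : ℝ) {ε : ℝ} (hε : ε ≠ 0) (k : 𝓢(ℝ, ℂ)) (ξ : ℝ) :
    rescale l hε k ξ = k (ε⁻¹ * (ξ - l)) := rfl

theorem fourierInv_rescale (l : ℝ) {ε : ℝ} (hε : ε ≠ 0) (k : 𝓢(ℝ, ℂ)) (s : ℝ) :
    (𝓕⁻ (rescale l hε k)) s = 𝐞 (l * s) • |ε| • (𝓕⁻ k) (ε * s) := by
  have h (f : 𝓢(ℝ, ℂ)) (w : ℝ) : (𝓕⁻ f) w = ∫ v, 𝐞 (v * w) • f v := by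
    simp [SchwartzMap.fourierInv_coe, Real.fourierInv_eq, mul_comm]
  calc (𝓕⁻ (rescale l hε k)) s
      = ∫ v, 𝐞 ((v + l) * s) • k (ε⁻¹ * v) := by
        rw [h, ← integral_add_right_eq_self _ l]
        simp only [rescale_apply, add_sub_cancel_right]
    _ = |ε| • ∫ v, 𝐞 ((ε * v + l) * s) • k v := by
        rw [← Measure.integral_comp_inv_mul_left]
        simp only [mul_inv_cancel_left₀ hε]
    _ = 𝐞 (l * s) • |ε| • (𝓕⁻ k) (ε * s) := by
        rw [h, smul_comm, Circle.smul_def, ← integral_smul (𝐞 (l * s) : ℂ)]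
        congr! 3 with v
        rw [← Circle.smul_def, ← mul_smul, ← AddChar.map_add_eq_mul]
        ring_nf

theorem integral_norm_fourierInv_rescale (l : ℝ) {ε : ℝ} (hε : ε ≠ 0) (k : 𝓢(ℝ, ℂ)) :
    ∫ s, ‖(𝓕⁻ (rescale l hε k)) s‖ = ∫ s, ‖(𝓕⁻ k) s‖ := by
  simp only [fourierInv_rescale, Circle.norm_smul, norm_smul, Real.norm_eq_abs, abs_abs,
    integral_const_mul]
  rw [Measure.integral_comp_mul_left (fun s => ‖(𝓕⁻ k : 𝓢(ℝ, ℂ)) s‖), smul_eq_mul, ← mul_assoc,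
    abs_inv, mul_inv_cancel₀ (abs_ne_zero.2 hε), one_mul]

variable (X : Type*) [NormedAddCommGroup X] [NormedSpace ℂ X]

theorem smul_sub_derivSymbol {k b : 𝓢(ℝ, ℂ)} {l ε : ℝ} (hε : 0 < ε)
    (hk : Function.support k ⊆ Metric.ball l ε) (hb : ∀ ξ ∈ Metric.closedBall 0 1, b ξ = 1) :
    (Complex.I * (2 * π * l : ℝ)) • k - derivSymbol k =
      -(ε : ℂ) • SchwartzMap.pairing (.mul ℂ ℂ) (rescale l hε.ne' (derivSymbol b)) k := by
  ext ξ
  rcases eq_or_ne (k ξ) 0 with h0 | h0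
  · simp [derivSymbol_apply, h0]
  · have hξ : b (ε⁻¹ * (ξ - l)) = 1 := by
      refine hb _ (mem_closedBall_zero_iff.2 ?_)
      rw [norm_mul, norm_inv, Real.norm_of_nonneg hε.le, inv_mul_le_one₀ hε]
      exact (mem_ball_iff_norm.1 (hk h0)).le
    have hε' : (ε : ℂ) ≠ 0 := by exact_mod_cast hε.ne'
    simp only [sub_apply, smul_apply, smul_eq_mul, SchwartzMap.pairing_apply_apply,
      ContinuousLinearMap.mul_apply', rescale_apply, derivSymbol_apply, hξ]
    push_cast
    field_simp
    ring

/-- **Bernstein's inequality** for the frequency band `(l - ε, l + ε)`. -/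
theorem exists_norm_smul_sub_deriv_fourierMultiplier_le [CompleteSpace X] :
    ∃ C, 0 ≤ C ∧ ∀ (u : ℝ →ᵇ X) (k : 𝓢(ℝ, ℂ)) (l ε : ℝ), 0 < ε →
      Function.support k ⊆ Metric.ball l ε → ∀ t,
      ‖(Complex.I * (2 * π * l : ℝ)) • fourierMultiplier u k t - deriv (fourierMultiplier u k) t‖ ≤
        C * ε * ‖fourierMultiplier u k‖ := by
  obtain ⟨b, -, hb⟩ := exists_schwartzMap_eq_one (0 : ℝ) one_pos one_lt_two
  refine ⟨∫ s, ‖(𝓕⁻ (derivSymbol b) : 𝓢(ℝ, ℂ)) s‖, by positivity, fun u k l ε hε hk t => ?_⟩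
  set w := fourierMultiplier u k with hw
  set a := rescale l hε.ne' (derivSymbol b)
  have hband : (Complex.I * (2 * π * l : ℝ)) • w t - deriv w t =
      -(ε : ℂ) • fourierMultiplier w a t := by
    rw [(hasDerivAt_fourierMultiplier u k t).deriv, hw, fourierMultiplier_fourierMultiplier]
    simpa using DFunLike.congr_fun
      (congrArg (fourierMultiplier u) (smul_sub_derivSymbol hε hk hb)) t
  calc ‖(Complex.I * (2 * π * l : ℝ)) • w t - deriv w t‖
      = ε * ‖fourierMultiplier w a t‖ := by
        rw [hband, norm_smul, norm_neg, Complex.norm_real, Real.norm_of_nonneg hε.le]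
    _ ≤ ε * ((∫ s, ‖(𝓕⁻ (derivSymbol b) : 𝓢(ℝ, ℂ)) s‖) * ‖w‖) := by
        gcongr
        rw [← integral_norm_fourierInv_rescale l hε.ne']
        exact (BoundedContinuousFunction.norm_coe_le_norm _ t).trans
          (norm_fourierMultiplier_le w _)
    _ = (∫ s, ‖(𝓕⁻ (derivSymbol b) : 𝓢(ℝ, ℂ)) s‖) * ε * ‖w‖ := by ring

variable {X}

theorem fourierMultiplier_rescale_zero {ε : ℝ} (hε : ε ≠ 0) (u : ℝ →ᵇ X) (k : 𝓢(ℝ, ℂ)) (t : ℝ) :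
    fourierMultiplier u (rescale 0 hε k) t = ∫ s, (𝓕⁻ k : 𝓢(ℝ, ℂ)) s • u (t - ε⁻¹ * s) := by
  calc fourierMultiplier u (rescale 0 hε k) t
      = |ε| • ∫ s, (𝓕⁻ k) (ε * s) • u (t - s) := by
        rw [fourierMultiplier_apply, scalarConv, ← integral_smul]
        simp only [fourierInv_rescale, zero_mul, AddChar.map_zero_eq_one, one_smul, smul_assoc]
    _ = ∫ s, (𝓕⁻ k : 𝓢(ℝ, ℂ)) s • u (t - ε⁻¹ * s) := by
        have := Measure.integral_comp_mul_left
          (fun s => (𝓕⁻ k : 𝓢(ℝ, ℂ)) s • u (t - ε⁻¹ * s)) ε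
        simp only [inv_mul_cancel_left₀ hε] at this
        rw [this, abs_inv, smul_inv_smul₀ (abs_ne_zero.2 hε)]

theorem tendsto_fourierMultiplier_rescale [CompleteSpace X] (u : ℝ →ᵇ X) (k : 𝓢(ℝ, ℂ)) (t : ℝ) :
    Tendsto (fun n : ℕ => fourierMultiplier u (rescale 0 (Nat.cast_add_one_ne_zero n) k) t) atTop
      (𝓝 (k 0 • u t)) := by
  have hint : ∫ s, (𝓕⁻ k) s = k 0 := by
    rw [← FourierTransform.fourier_fourierInv_eq (F := 𝓢(ℝ, ℂ)) k, SchwartzMap.fourier_coe,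
      Real.fourier_real_eq_integral_exp_smul]
    simp
  simp only [fourierMultiplier_rescale_zero]
  rw [← hint, ← integral_smul_const]
  refine tendsto_integral_of_dominated_convergence (fun s => ‖(𝓕⁻ k) s‖ * ‖u‖)
    (fun n => Continuous.aestronglyMeasurable ?_) ((𝓕⁻ k).integrable.norm.mul_const _)
    (fun n => .of_forall fun s => ?_) (.of_forall fun s => ?_)
  · have := (𝓕⁻ k : 𝓢(ℝ, ℂ)).continuous
    fun_prop
  · rw [norm_smul]
    gcongr
    exact u.norm_coe_le_norm _
  · refine Tendsto.const_smul ((u.continuous.tendsto t).comp ?_) _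
    have h0 : Tendsto (fun n : ℕ => ((n : ℝ) + 1)⁻¹) atTop (𝓝 0) := by
      simpa using tendsto_one_div_add_atTop_nhds_zero_nat (𝕜 := ℝ)
    simpa using (h0.mul_const s).const_sub t

end Rescaling

section Support

theorem map_eq_zero_of_disjoint_dsupport {E W V L : Type*} [NormedAddCommGroup E]
    [NormedSpace ℝ E] [FiniteDimensional ℝ E] [NormedAddCommGroup W] [NormedSpace ℝ W]
    [AddCommMonoid V] [FunLike L 𝓢(E, W) V] [AddMonoidHomClass L 𝓢(E, W) V] (f : L) {k : 𝓢(E, W)}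
    (hk : HasCompactSupport k) (hd : Disjoint (tsupport k) (dsupport f)) :
    f k = 0 := by
  have hloc (x : tsupport k) : ∃ s, IsVanishingOn f s ∧ IsOpen s ∧ (x : E) ∈ s :=
    (notMem_dsupport_iff _).1 (hd.notMem_of_mem_left x.2)
  choose U hU hUo hxU using hloc
  obtain ⟨ρ, hρ⟩ := SmoothPartitionOfUnity.exists_isSubordinate 𝓘(ℝ, E) (isClosed_tsupport k) U
    hUo fun x hx => Set.mem_iUnion.2 ⟨⟨x, hx⟩, hxU _⟩
  let K (i : tsupport k) : 𝓢(E, W) :=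
    (hk.smul_left (f := ρ i)).toSchwartzMap ((ρ i).contMDiff.contDiff.smul k.smooth')
  have hfin := ρ.locallyFinite.finite_nonempty_inter_compact hk
  have hsum : k = ∑ i ∈ hfin.toFinset, K i := by
    ext ξ
    rw [sum_apply]
    change k ξ = ∑ i ∈ hfin.toFinset, ρ i ξ • k ξ
    by_cases hξ : ξ ∈ tsupport k
    · have hsub : ρ.finsupport ξ ⊆ hfin.toFinset := fun i hi =>
        hfin.mem_toFinset.2 ⟨ξ, (ρ.mem_finsupport ξ).1 hi, hξ⟩
      rw [← Finset.sum_smul, ρ.sum_finsupport' ξ hξ hsub, one_smul]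
    · simp [image_eq_zero_of_notMem_tsupport hξ]
  rw [hsum, map_sum]
  exact Finset.sum_eq_zero fun i _ => hU i _ ((tsupport_smul_subset_left _ _).trans (hρ i))

theorem eq_zero_of_dsupport_fourierMultiplier_eq_empty {X : Type*} [NormedAddCommGroup X]
    [NormedSpace ℂ X] [CompleteSpace X] {u : ℝ →ᵇ X}
    (hu : dsupport (fourierMultiplier u) = ∅) : u = 0 := by
  obtain ⟨b, hbs, hb⟩ := exists_schwartzMap_eq_one (0 : ℝ) one_pos one_lt_two
  have hbc : HasCompactSupport b := (isCompact_closedBall _ _).of_isClosed_subset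
    (isClosed_tsupport b) hbs
  have hzero (n : ℕ) : fourierMultiplier u (rescale 0 (Nat.cast_add_one_ne_zero n) b) = 0 := by
    refine map_eq_zero_of_disjoint_dsupport _ ?_ (by simp [hu])
    exact hbc.comp_homeomorph ((Homeomorph.subRight 0).trans
      (Homeomorph.mulLeft₀ _ (inv_ne_zero (Nat.cast_add_one_ne_zero n))))
  ext t
  have hlim := tendsto_fourierMultiplier_rescale u b t
  simp only [hzero, hb 0 (Metric.mem_closedBall_self zero_le_one), one_smul] at hlim
  exact tendsto_nhds_unique hlim tendsto_const_nhds

end Support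

section Trajectory

variable {X : Type*} [NormedAddCommGroup X] [NormedSpace ℂ X]

theorem C0Semigroup.exists_norm_op_le [CompleteSpace X] (T : C0Semigroup X) (a : ℝ≥0) :
    ∃ M, ∀ t ≤ a, ‖T.op t‖ ≤ M := by
  have hbdd (x : X) : ∃ C, ∀ t : Set.Icc 0 a, ‖T.op t x‖ ≤ C := by
    obtain ⟨C, hC⟩ := isCompact_Icc.exists_bound_of_continuousOn (T.continuous_orbit x).continuousOn
    exact ⟨C, fun t => hC t t.2⟩
  obtain ⟨M, hM⟩ := banach_steinhaus hbdd
  exact ⟨M, fun t ht => hM ⟨t, zero_le, ht⟩⟩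

/-- A complete trajectory of the semigroup `T`, that is, a mild solution of `u' = A u` on the whole
line, where `A` is the generator. -/
def C0Semigroup.IsTrajectory (T : C0Semigroup X) (u : ℝ → X) : Prop :=
  ∀ (t : ℝ) (h : ℝ≥0), u (t + h) = T.op h (u t)

namespace C0Semigroup.IsTrajectory

variable {T : C0Semigroup X}

theorem apply_eq {u : ℝ → X} (hu : T.IsTrajectory u) {s t : ℝ} (hst : s ≤ t) :
    u t = T.op (t - s).toNNReal (u s) := by
  rw [← hu, Real.coe_toNNReal _ (sub_nonneg.2 hst), add_sub_cancel]

theorem continuous {u : ℝ → X} (hu : T.IsTrajectory u) : Continuous u := by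
  refine continuous_iff_continuousAt.2 fun t => ?_
  have hc : Continuous fun r : ℝ => T.op (r - (t - 1)).toNNReal (u (t - 1)) :=
    (T.continuous_orbit _).comp (by fun_prop)
  refine hc.continuousAt.congr ?_
  filter_upwards [Ioi_mem_nhds (sub_one_lt t)] with r hr
  exact (hu.apply_eq hr.le).symm

theorem exists_norm_le_of_stepanovNorm_lt_top [CompleteSpace X] {u : ℝ → X}
    (hu : T.IsTrajectory u) (hS : stepanovNorm u < ∞) : ∃ C, ∀ t, ‖u t‖ ≤ C := by
  obtain ⟨M, hM⟩ := T.exists_norm_op_le 1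
  have henorm (t : ℝ) : ‖u t‖ₑ ≤ ENNReal.ofReal M * stepanovNorm u := by
    calc ‖u t‖ₑ = ∫⁻ _ in Set.Icc (0 : ℝ) 1, ‖u t‖ₑ := by simp
      _ ≤ ∫⁻ s in Set.Icc (0 : ℝ) 1, ENNReal.ofReal M * ‖u (s + (t - 1))‖ₑ := by
        refine setLIntegral_mono' measurableSet_Icc fun s hs => ?_
        rw [hu.apply_eq (by linarith [hs.2] : s + (t - 1) ≤ t)]
        refine ((T.op _).le_opENorm _).trans ?_
        gcongr
        rw [← ofReal_norm]
        refine ENNReal.ofReal_le_ofReal (hM _ (Real.toNNReal_le_one.2 ?_))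
        linarith [hs.1]
      _ = ENNReal.ofReal M * ∫⁻ s in Set.Icc (0 : ℝ) 1, ‖u (s + (t - 1))‖ₑ :=
        lintegral_const_mul' _ _ ENNReal.ofReal_ne_top
      _ ≤ ENNReal.ofReal M * stepanovNorm u := by
        gcongr
        exact le_iSup (fun t : ℝ => ∫⁻ s in Set.Icc (0 : ℝ) 1, ‖u (s + t)‖ₑ) (t - 1)
  have hfin : ENNReal.ofReal M * stepanovNorm u ≠ ∞ :=
    ENNReal.mul_ne_top ENNReal.ofReal_ne_top hS.ne
  exact ⟨_, fun t => toReal_enorm (u t) ▸ ENNReal.toReal_mono hfin (henorm t)⟩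

theorem scalarConv [CompleteSpace X] {u : ℝ →ᵇ X} (hu : T.IsTrajectory u) {f : ℝ → ℂ}
    (hf : Integrable f) : T.IsTrajectory (scalarConv f u) := by
  intro t h
  calc ∫ s, f s • u (t + h - s) = ∫ s, T.op h (f s • u (t - s)) := by
        simp only [map_smul, ← hu (_ - _), sub_add_eq_add_sub]
    _ = T.op h (∫ s, f s • u (t - s)) :=
        (T.op h).integral_comp_comm (integrable_smul_comp_sub_left hf u t)

theorem hasGeneratorAt_of_hasDerivAt {u : ℝ → X} (hu : T.IsTrajectory u) {t : ℝ} {y : X}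
    (h : HasDerivAt u y t) : T.HasGeneratorAt (u t) y := by
  refine h.tendsto_slope_zero_right.congr' ?_
  filter_upwards [self_mem_nhdsWithin] with r hr
  rw [← hu, Real.coe_toNNReal _ (le_of_lt hr), ← Complex.ofReal_inv, Complex.coe_smul]

end C0Semigroup.IsTrajectory

theorem C0Semigroup.HasGeneratorAt.eq_apply_sub {T : C0Semigroup X} {x y : X}
    (h : T.HasGeneratorAt x y) {z : ℂ} {R : X →L[ℂ] X}
    (hR : ∀ x : T.generator.domain, R (z • (x : X) - T.generator x) = x) :
    x = R (z • x - y) := by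
  have hx := hR ⟨x, y, h⟩
  rwa [(T.generator_spec ⟨x, y, h⟩).unique h, eq_comm] at hx

theorem C0Semigroup.IsTrajectory.notMem_dsupport_fourierMultiplier [CompleteSpace X]
    {T : C0Semigroup X} {u : ℝ →ᵇ X} (hu : T.IsTrajectory u) {l : ℝ}
    (hl : Complex.I * (2 * π * l : ℝ) ∈ unboundedResolventSet T.generator) :
    l ∉ dsupport (fourierMultiplier u) := by
  obtain ⟨R, -, hR⟩ := hl
  obtain ⟨C, hC0, hC⟩ := exists_norm_smul_sub_deriv_fourierMultiplier_le X
  obtain ⟨ε, hε, hε1⟩ := exists_pos_mul_lt one_pos (‖R‖ * C)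
  refine (notMem_dsupport_iff l).2
    ⟨Metric.ball l ε, fun k hk => ?_, Metric.isOpen_ball, Metric.mem_ball_self hε⟩
  set w := fourierMultiplier u k
  have hwT : T.IsTrajectory w := hu.scalarConv (𝓕⁻ k).integrable
  have hwR (t : ℝ) : w t = R ((Complex.I * (2 * π * l : ℝ)) • w t - deriv w t) :=
    (hwT.hasGeneratorAt_of_hasDerivAt
      (hasDerivAt_fourierMultiplier u k t).differentiableAt.hasDerivAt).eq_apply_sub hR
  have hwle : ‖w‖ ≤ ‖R‖ * C * ε * ‖w‖ := by
    refine (BoundedContinuousFunction.norm_le (by positivity)).2 fun t => ?_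
    rw [hwR t, mul_assoc ‖R‖, mul_assoc ‖R‖]
    exact R.le_opNorm_of_le (hC u k l ε hε ((subset_tsupport k).trans hk) t)
  exact norm_le_zero_iff.1 (by nlinarith [norm_nonneg w])

end Trajectory

section FunctionSpace

theorem fourierL1_fourierInv (k : 𝓢(ℝ, ℂ)) (l : ℝ) :
    fourierL1 (𝓕⁻ k : 𝓢(ℝ, ℂ)) (2 * π * l) = k l := by
  conv_rhs => rw [← FourierTransform.fourier_fourierInv_eq (F := 𝓢(ℝ, ℂ)) k]
  rw [SchwartzMap.fourier_coe, Real.fourier_real_eq_integral_exp_smul, fourierL1]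
  congr! 2 with s
  rw [smul_eq_mul, mul_comm]
  congr 2
  push_cast
  ring

theorem stepanovNorm_congr {X : Type*} [NormedAddCommGroup X] {u v : ℝ → X}
    (h : u =ᵐ[volume] v) : stepanovNorm u = stepanovNorm v := by
  unfold stepanovNorm
  congr! 2 with t
  refine lintegral_congr_ae (ae_restrict_of_ae ?_)
  filter_upwards [(quasiMeasurePreserving_add_right volume t).ae h] with s hs
  rw [hs]

variable {X F : Type*} [NormedAddCommGroup X] [NormedSpace ℂ X] [NormedAddCommGroup F]
  [NormedSpace ℂ F] {ι : F →ₗ[ℂ] (ℝ →ₘ[volume] X)} {T : C0Semigroup X}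

theorem notMem_beurlingSpectrum_of_notMem_dsupport {x : F} {u : ℝ →ᵇ X} (hu : u =ᵐ[volume] ι x)
    {l : ℝ} (hl : l ∉ dsupport (fourierMultiplier u)) :
    2 * π * l ∉ beurlingSpectrum ι x := by
  obtain ⟨U, hU, hUo, hlU⟩ := (notMem_dsupport_iff l).1 hl
  obtain ⟨ε, hε, hεU⟩ := Metric.nhds_basis_closedBall.mem_iff.1 (hUo.mem_nhds hlU)
  obtain ⟨b, hbs, hb⟩ := exists_schwartzMap_eq_one l (half_pos hε) (half_lt_self hε)
  refine Set.notMem_compl_iff.2 ⟨(𝓕⁻ b : 𝓢(ℝ, ℂ)), (𝓕⁻ b).integrable, ?_, .of_eq ?_⟩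
  · rw [fourierL1_fourierInv, hb l (Metric.mem_closedBall_self (half_pos hε).le)]
    exact one_ne_zero
  · rw [← scalarConv_congr _ hu]
    exact congrArg DFunLike.coe (hU b (hbs.trans hεU))

theorem mem_parabolicKer_iff {x : F} :
    x ∈ parabolicKer T ι ↔ ∃ u : ℝ → X, u =ᵐ[volume] ι x ∧ T.IsTrajectory u := by
  have hzero (s t : ℝ) : ∫ τ in s..t, T.op (t - τ).toNNReal (ι 0 τ) = 0 := by simp
  simp only [parabolicKer, parabolicGraph, Set.mem_ofPred_eq, hzero, sub_zero]
  refine exists_congr fun u => and_congr_right fun _ => ⟨fun H t h => ?_, fun H s t => H.apply_eq⟩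
  simpa using H t (t + h) (by simp)

theorem zero_mem_parabolicKer : (0 : F) ∈ parabolicKer T ι :=
  mem_parabolicKer_iff.2 ⟨0, by rw [map_zero]; exact AEEqFun.coeFn_zero.symm, fun t h => by simp⟩

theorem sub_mem_parabolicKer {x₁ x₂ y : F} (h₁ : (x₁, y) ∈ parabolicGraph T ι)
    (h₂ : (x₂, y) ∈ parabolicGraph T ι) : x₁ - x₂ ∈ parabolicKer T ι := by
  obtain ⟨u₁, hu₁, H₁⟩ := h₁
  obtain ⟨u₂, hu₂, H₂⟩ := h₂
  refine mem_parabolicKer_iff.2 ⟨u₁ - u₂, ?_, fun t h => ?_⟩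
  · rw [map_sub]
    exact (hu₁.sub hu₂).trans (AEEqFun.coeFn_sub _ _).symm
  · rw [Pi.sub_apply, Pi.sub_apply, H₁ t (t + h) (by simp), H₂ t (t + h) (by simp), map_sub]
    simp

theorem parabolicInjective_of_parabolicKer_subset (h : parabolicKer T ι ⊆ {0}) :
    ParabolicInjective T ι :=
  ⟨h.antisymm (Set.singleton_subset_iff.2 zero_mem_parabolicKer),
    fun _ _ _ h₁ h₂ => sub_eq_zero.1 (h (sub_mem_parabolicKer h₁ h₂))⟩

variable [CompleteSpace X]

theorem exists_boundedContinuous_of_mem_parabolicKer {x : F} (hS : stepanovNorm (ι x) < ∞)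
    (hx : x ∈ parabolicKer T ι) : ∃ u : ℝ →ᵇ X, u =ᵐ[volume] ι x ∧ T.IsTrajectory u := by
  obtain ⟨u, hu, hT⟩ := mem_parabolicKer_iff.1 hx
  obtain ⟨C, hC⟩ := hT.exists_norm_le_of_stepanovNorm_lt_top ((stepanovNorm_congr hu).trans_lt hS)
  exact ⟨.ofNormedAddCommGroup u hT.continuous C hC, hu, hT⟩

theorem notMem_beurlingSpectrum_of_mem_parabolicKer {x : F} (hS : stepanovNorm (ι x) < ∞)
    (hx : x ∈ parabolicKer T ι) {l : ℝ}
    (hl : Complex.I * (l : ℂ) ∈ unboundedResolventSet T.generator) :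
    l ∉ beurlingSpectrum ι x := by
  obtain ⟨u, hu, hT⟩ := exists_boundedContinuous_of_mem_parabolicKer hS hx
  have hl' : l = 2 * π * (l / (2 * π)) := by field_simp
  rw [hl'] at hl ⊢
  exact notMem_beurlingSpectrum_of_notMem_dsupport hu (hT.notMem_dsupport_fourierMultiplier hl)

theorem eq_zero_of_mem_parabolicKer (hι : Function.Injective ι) {x : F}
    (hS : stepanovNorm (ι x) < ∞) (hx : x ∈ parabolicKer T ι)
    (hT : ∀ l : ℝ, Complex.I * (l : ℂ) ∈ unboundedResolventSet T.generator) : x = 0 := by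
  obtain ⟨u, hu, hTu⟩ := exists_boundedContinuous_of_mem_parabolicKer hS hx
  have hu0 : u = 0 := eq_zero_of_dsupport_fourierMultiplier_eq_empty
    (Set.eq_empty_of_forall_notMem fun l => hTu.notMem_dsupport_fourierMultiplier (hT _))
  refine hι (AEEqFun.ext (hu.symm.trans ?_))
  rw [hu0, map_zero]
  exact AEEqFun.coeFn_zero.symm

end FunctionSpace

end AbstractParabolic

end

theorem lemma3p1_general {X : Type*} [NormedAddCommGroup X] [NormedSpace ℂ X] [CompleteSpace X]
    (T : AbstractParabolic.C0Semigroup X) {F : Type*} [NormedAddCommGroup F] [NormedSpace ℂ F]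
    (ι : F →ₗ[ℂ] (ℝ →ₘ[volume] X)) (hι : Function.Injective ι)
    (hS : ∀ x, AbstractParabolic.stepanovNorm (ι x) < ∞) :
    (∀ x ∈ AbstractParabolic.parabolicKer T ι,
      (fun l : ℝ => Complex.I * (l : ℂ)) '' AbstractParabolic.beurlingSpectrum ι x ⊆
        AbstractParabolic.unboundedSpectrum T.generator ∩
          Set.range (fun l : ℝ => Complex.I * (l : ℂ))) ∧
    (AbstractParabolic.unboundedSpectrum T.generator ∩
        Set.range (fun l : ℝ => Complex.I * (l : ℂ)) = ∅ →
      AbstractParabolic.ParabolicInjective T ι) := by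
  refine ⟨fun x hx => ?_, fun h => ?_⟩
  · rintro _ ⟨l, hl, rfl⟩
    exact ⟨fun hρ => AbstractParabolic.notMem_beurlingSpectrum_of_mem_parabolicKer (hS x) hx hρ hl,
      l, rfl⟩
  · have hT (l : ℝ) : Complex.I * (l : ℂ) ∈ AbstractParabolic.unboundedResolventSet T.generator :=
      not_not.1 fun hσ => Set.eq_empty_iff_forall_notMem.1 h _ ⟨hσ, l, rfl⟩
    exact AbstractParabolic.parabolicInjective_of_parabolicKer_subset fun x hx =>
      AbstractParabolic.eq_zero_of_mem_parabolicKer hι (hS x) hx hT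

theorem lemma3p1 {X : Type*} [NormedAddCommGroup X] [NormedSpace ℂ X] [CompleteSpace X]
    (T : AbstractParabolic.C0Semigroup X)
    {F : Type*} [NormedAddCommGroup F] [NormedSpace ℂ F] [CompleteSpace F]
    (ι : F →ₗ[ℂ] (ℝ →ₘ[volume] X)) (hF : AbstractParabolic.IsHomogeneous ι) :
    (∀ x ∈ AbstractParabolic.parabolicKer T ι,
      (fun l : ℝ => Complex.I * (l : ℂ)) '' AbstractParabolic.beurlingSpectrum ι x ⊆
        AbstractParabolic.unboundedSpectrum T.generator ∩
          Set.range (fun l : ℝ => Complex.I * (l : ℂ))) ∧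
    (AbstractParabolic.unboundedSpectrum T.generator ∩
        Set.range (fun l : ℝ => Complex.I * (l : ℂ)) = ∅ →
      AbstractParabolic.ParabolicInjective T ι) := by
  obtain ⟨C, hC⟩ := hF.stepanov
  exact lemma3p1_general T ι hF.injective fun x =>
    (hC x).trans_lt (ENNReal.mul_lt_top ENNReal.coe_lt_top enorm_lt_top)
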